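/- Let $n\ge 2$ and $k\ge 1$ be integers and let $dx$ be the rotation invariant probability measure on the unit sphere $\mathbb S^{n-1}\subset\mathbb R^n$. Let $U_{2k,n}$ be the space of real homogeneous polynomials $p$ of degree $2k$ in $n$ variables with $\int_{\mathbb S^{n-1}}p(x)\,dx=0$, made into a Euclidean space by the inner product $\langle f,g\rangle=\int_{\mathbb S^{n-1}}f(x)g(x)\,dx$, and let $K\subset U_{2k,n}$ be its unit ball. Let $Pos_{2k,n}$ be the set of real homogeneous polynomials $p$ of degree $2k$ in $n$ variables with $p(x)\ge 0$ for all $x\in\mathbb R^n$ and $\int_{\mathbb S^{n-1}}p(x)\,dx=1$, and let $$Pos'_{2k,n}=\bigl\{p-(x_1^2+\dots+x_n^2)^k:\ p\in Pos_{2k,n}\bigr\}\subset U_{2k,n}$$ be its translate. Let $d=\dim U_{2k,n}$ and let $\operatorname{vol}$ be the volume in the Euclidean space $U_{2k,n}$. Then $d=\binom{n+2k-1}{2k}-1$, and $$\left(\frac{\operatorname{vol} Pos'_{2k,n}}{\operatorname{vol} K}\right)^{1/d}\ \ge\ \alpha\,\bigl(n\ln(2k+1)\bigr)^{-1/2}$$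 for some absolute constant $\alpha>0$ (independent of $n$ and $k$). -/

import Mathlib

open MeasureTheory

namespace NonnegForms

noncomputable section

/-- The Euclidean unit sphere `𝕊ⁿ⁻¹ ⊂ ℝⁿ`. -/
abbrev Sphere (n : ℕ) : Type := Metric.sphere (0 : EuclideanSpace ℝ (Fin n)) 1

/-- The rotation invariant probability measure on `𝕊ⁿ⁻¹`: the surface measure divided by
its total mass. -/
def sphereMeasure (n : ℕ) : Measure (Sphere n) :=
  ((volume : Measure (EuclideanSpace ℝ (Fin n))).toSphere Set.univ)⁻¹ •
    (volume : Measure (EuclideanSpace ℝ (Fin n))).toSphere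

/-- The restriction of a polynomial to the unit sphere. -/
def onSphere {n : ℕ} (p : MvPolynomial (Fin n) ℝ) (x : Sphere n) : ℝ :=
  MvPolynomial.eval (x : EuclideanSpace ℝ (Fin n)).ofLp p

instance sphereMeasure_isProbabilityMeasure (n : ℕ) [NeZero n] :
    IsProbabilityMeasure (sphereMeasure n) := by
  have h0 : (volume : Measure (EuclideanSpace ℝ (Fin n))).toSphere Set.univ ≠ 0 := by
    rw [ne_eq, Measure.measure_univ_eq_zero]
    exact Measure.toSphere_ne_zero _
  refine ⟨?_⟩
  rw [sphereMeasure, Measure.smul_apply, smul_eq_mul]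
  exact ENNReal.inv_mul_cancel h0 (measure_ne_top _ _)

instance sphereMeasure_isFiniteMeasure (n : ℕ) : IsFiniteMeasure (sphereMeasure n) := by
  rcases Nat.eq_zero_or_pos n with rfl | h
  · have : (volume : Measure (EuclideanSpace ℝ (Fin 0))).toSphere = 0 := by
      rw [Measure.toSphere_eq_zero_iff]; infer_instance
    rw [sphereMeasure, this, smul_zero]
    infer_instance
  · have : NeZero n := ⟨h.ne'⟩
    infer_instance

instance sphereMeasure_isOpenPosMeasure (n : ℕ) : (sphereMeasure n).IsOpenPosMeasure := by
  refine ⟨fun U hU hne h => ?_⟩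
  rw [sphereMeasure, Measure.smul_apply, smul_eq_mul, mul_eq_zero] at h
  rcases h with h | h
  · exact (measure_ne_top _ _) (ENNReal.inv_eq_zero.1 h)
  · exact hU.measure_ne_zero _ hne h

theorem continuous_onSphere {n : ℕ} (p : MvPolynomial (Fin n) ℝ) : Continuous (onSphere p) := by
  unfold onSphere
  exact (MvPolynomial.continuous_eval p).comp (by fun_prop)

theorem integrable_of_continuous {n : ℕ} {f : Sphere n → ℝ} (hf : Continuous f) :
    Integrable f (sphereMeasure n) :=
  hf.integrable_of_hasCompactSupport (HasCompactSupport.of_compactSpace f)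

theorem eval_smul_of_isHomogeneous {n m : ℕ} {p : MvPolynomial (Fin n) ℝ}
    (hp : p.IsHomogeneous m) (r : ℝ) (x : Fin n → ℝ) :
    MvPolynomial.eval (r • x) p = r ^ m * MvPolynomial.eval x p := by
  rw [MvPolynomial.eval_eq, MvPolynomial.eval_eq, Finset.mul_sum]
  refine Finset.sum_congr rfl fun d hd => ?_
  have hdeg : ∑ i ∈ d.support, d i = m := by
    have := hp (MvPolynomial.mem_support_iff.1 hd)
    simpa [Finsupp.weight_apply, Finsupp.sum] using this
  simp only [Pi.smul_apply, smul_eq_mul, mul_pow, Finset.prod_mul_distrib,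
    Finset.prod_pow_eq_pow_sum, hdeg]
  ring

/-- A homogeneous polynomial that vanishes on the unit sphere is zero. -/
theorem eq_zero_of_onSphere_eq_zero {n m : ℕ} [NeZero n] {p : MvPolynomial (Fin n) ℝ}
    (hp : p.IsHomogeneous m) (h : ∀ x, onSphere p x = 0) : p = 0 := by
  have key : ∀ y : EuclideanSpace ℝ (Fin n), y ≠ 0 → MvPolynomial.eval y.ofLp p = 0 := by
    intro y hy
    have hn : ‖y‖ ≠ 0 := norm_ne_zero_iff.2 hy
    have h1 := h ⟨‖y‖⁻¹ • y, by simp [norm_smul, hn]⟩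
    have h3 : MvPolynomial.eval (‖y‖ • (‖y‖⁻¹ • y)).ofLp p =
        ‖y‖ ^ m * MvPolynomial.eval (‖y‖⁻¹ • y).ofLp p := by
      exact eval_smul_of_isHomogeneous hp ‖y‖ (‖y‖⁻¹ • y).ofLp
    rw [smul_inv_smul₀ hn] at h3
    rw [h3]
    have : MvPolynomial.eval (‖y‖⁻¹ • y).ofLp p = 0 := h1
    rw [this, mul_zero]
  have hcont : Continuous fun y : EuclideanSpace ℝ (Fin n) => MvPolynomial.eval y.ofLp p :=
    (MvPolynomial.continuous_eval p).comp (by fun_prop)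
  have hall : (fun y : EuclideanSpace ℝ (Fin n) => MvPolynomial.eval y.ofLp p) = fun _ => 0 :=
    hcont.ext_on (dense_compl_singleton (0 : EuclideanSpace ℝ (Fin n))) continuous_const
      (fun y hy => key y hy)
  exact MvPolynomial.funext fun x => by simpa using congrFun hall (WithLp.toLp 2 x)

/-- The subspace `U_{m,n}` of the real homogeneous polynomials of degree `m` in `n` variables whose average
over the unit sphere is `0`. -/
def zeroMeanForms (m n : ℕ) : Submodule ℝ (MvPolynomial (Fin n) ℝ) where
  carrier := {p | p.IsHomogeneous m ∧ ∫ x, onSphere p x ∂(sphereMeasure n) = 0}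
  zero_mem' := ⟨MvPolynomial.isHomogeneous_zero _ _ _, by simp [onSphere]⟩
  add_mem' := by
    rintro p q ⟨hp, hp'⟩ ⟨hq, hq'⟩
    refine ⟨hp.add hq, ?_⟩
    have := integral_add (integrable_of_continuous (continuous_onSphere p))
      (integrable_of_continuous (continuous_onSphere q))
    rw [hp', hq', add_zero] at this
    simpa [onSphere] using this
  smul_mem' := by
    rintro c p ⟨hp, hp'⟩
    refine ⟨(MvPolynomial.homogeneousSubmodule (Fin n) ℝ m).smul_mem c hp, ?_⟩
    have := integral_const_mul (μ := sphereMeasure n) c (onSphere p)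
    rw [hp', mul_zero] at this
    simpa [onSphere] using this

/-- `U_{m,n}` as a type of its own, so that it carries no topology or measure inherited from
the ambient polynomial ring: these come from the `L²` inner product below. -/
def U (m n : ℕ) : Type := zeroMeanForms m n

instance addCommGroup_U (m n : ℕ) : AddCommGroup (U m n) :=
  inferInstanceAs (AddCommGroup (zeroMeanForms m n))

instance module_U (m n : ℕ) : Module ℝ (U m n) :=
  inferInstanceAs (Module ℝ (zeroMeanForms m n))

/-- The inclusion of `U_{m,n}` into the polynomial ring. -/
def U.toPoly {m n : ℕ} : U m n →ₗ[ℝ] MvPolynomial (Fin n) ℝ := (zeroMeanForms m n).subtype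

theorem U.toPoly_injective {m n : ℕ} : Function.Injective (U.toPoly (m := m) (n := n)) :=
  Subtype.val_injective

theorem U.isHomogeneous {m n : ℕ} (f : U m n) : f.toPoly.IsHomogeneous m := f.2.1

instance finiteDimensional_U (m n : ℕ) : FiniteDimensional ℝ (U m n) := by
  have : FiniteDimensional ℝ (MvPolynomial.homogeneousSubmodule (Fin n) ℝ m) :=
    Module.Finite.iff_fg.2 (MvPolynomial.homogeneousSubmodule_fg _ _ m)
  have h : zeroMeanForms m n ≤ MvPolynomial.homogeneousSubmodule (Fin n) ℝ m := fun p hp => hp.1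
  exact Submodule.finiteDimensional_of_le h

/-- The `L²` inner product `⟨f, g⟩ = ∫ f g` over the unit sphere, on `U_{m,n}`. -/
abbrev l2Core (m n : ℕ) [NeZero n] : InnerProductSpace.Core ℝ (U m n) where
  inner f g := ∫ x, onSphere f.toPoly x * onSphere g.toPoly x ∂(sphereMeasure n)
  conj_inner_symm f g := by simp [mul_comm]
  re_inner_nonneg f := integral_nonneg fun x => mul_self_nonneg _
  add_left f g h := by
    have := integral_add
      (integrable_of_continuous ((continuous_onSphere f.toPoly).mul (continuous_onSphere h.toPoly)))
      (integrable_of_continuous ((continuous_onSphere g.toPoly).mul (continuous_onSphere h.toPoly)))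
    simpa [onSphere, add_mul] using this
  smul_left f g c := by
    have := integral_const_mul (μ := sphereMeasure n) c
      (fun x => onSphere f.toPoly x * onSphere g.toPoly x)
    simpa [onSphere, mul_assoc] using this
  definite f hf := by
    have hc : Continuous fun x => onSphere f.toPoly x * onSphere f.toPoly x :=
      (continuous_onSphere f.toPoly).mul (continuous_onSphere f.toPoly)
    have h0 := (integral_eq_zero_iff_of_nonneg (fun x => mul_self_nonneg (onSphere f.toPoly x))
      (integrable_of_continuous hc)).1 hf
    have h1 := (Continuous.ae_eq_iff_eq (sphereMeasure n) hc continuous_const).1 h0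
    exact U.toPoly_injective (by
      rw [map_zero]
      exact eq_zero_of_onSphere_eq_zero f.isHomogeneous fun x => mul_self_eq_zero.1 (congrFun h1 x))

/-- `U_{m,n}` is a Euclidean space with the `L²` inner product. -/
instance normedAddCommGroup_U (m n : ℕ) [NeZero n] : NormedAddCommGroup (U m n) :=
  (l2Core m n).toNormedAddCommGroup

instance innerProductSpace_U (m n : ℕ) [NeZero n] : InnerProductSpace ℝ (U m n) :=
  InnerProductSpace.ofCore (l2Core m n).toCore

instance measurableSpace_U (m n : ℕ) [NeZero n] : MeasurableSpace (U m n) := borel _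

instance borelSpace_U (m n : ℕ) [NeZero n] : BorelSpace (U m n) := ⟨rfl⟩

/-- `Pos_{2k,n}`: the nonnegative homogeneous polynomials of degree `2k` in `n` variables whose
average over the unit sphere is `1`. -/
def Pos (k n : ℕ) : Set (MvPolynomial (Fin n) ℝ) :=
  {p | p.IsHomogeneous (2 * k) ∧ (∀ x : Fin n → ℝ, 0 ≤ MvPolynomial.eval x p) ∧
    ∫ x, onSphere p x ∂(sphereMeasure n) = 1}

/-- `Pos'_{2k,n} ⊂ U_{2k,n}`: the image of `Pos_{2k,n}` under the translation
`p ↦ p - (x₁² + ⋯ + xₙ²)ᵏ`. -/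
def Pos' (k n : ℕ) : Set (U (2 * k) n) :=
  {u | ∃ p ∈ Pos k n, u.toPoly = p - (∑ i, MvPolynomial.X i ^ 2) ^ k}

end

end NonnegForms

/-! ### Rotation invariance and the reproducing kernel -/

namespace NonnegForms

open scoped Pointwise

/-! A form `u` with `|u| ≤ M` on the sphere satisfies `u / M ∈ Pos'`, so it suffices that at least
half of the unit ball `K` has sup norm at most `M`, with `M` of order `√(n ln(2k+1))`: then `vol K ≤
2 M ^ d vol Pos'`, and the `d`-th root is taken.

Evaluation at a point is the inner product with a kernel of squared norm exactly `d`, by rotation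
invariance (`norm_kernelAt_sq`). Caps of `K` therefore have Gaussian tails, and the `2p`-th moment
of `u(x)` over `K` is at most `2 * 2 ^ p * p!` times `vol K` (`lintegral_inner_pow_le`). Tonelli and
Markov bound `∫ u ^ (2p)` for half of `K`.

To pass from the `2p`-norm to the sup norm, the kernel bound is applied to `u ^ p`, a form of degree
`2kp` (`onSphere_pow_le`). The loss is the dimension of that space, at most `e ^ (2p)` once `p ≥ n
ln(2k+1)` (`choose_le_exp`), hence a constant factor after the `2p`-th root. -/

/-- The action of a linear isometry on the unit sphere. -/
noncomputable def rotate {n : ℕ} (T : EuclideanSpace ℝ (Fin n) ≃ₗᵢ[ℝ] EuclideanSpace ℝ (Fin n))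
    (x : Sphere n) : Sphere n :=
  ⟨T x, by simp⟩

/-- Up to a constant, the surface measure of `s` is the Lebesgue measure of the truncated cone
`(0,1) • s`; an isometry preserves Lebesgue measure and carries cones to cones. -/
theorem measurePreserving_rotate {n : ℕ}
    (T : EuclideanSpace ℝ (Fin n) ≃ₗᵢ[ℝ] EuclideanSpace ℝ (Fin n)) :
    MeasurePreserving (rotate T) (sphereMeasure n) (sphereMeasure n) := by
  have hc : Continuous (rotate T) := by
    unfold rotate
    fun_prop
  refine MeasurePreserving.smul_measure ⟨hc.measurable, ?_⟩ _
  ext s hs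
  rw [Measure.map_apply hc.measurable hs, Measure.toSphere_apply' _ hs,
    Measure.toSphere_apply' _ (hc.measurable hs)]
  congr 1
  have h : (Set.Ioo (0 : ℝ) 1 • ((↑) '' (rotate T ⁻¹' s)) : Set (EuclideanSpace ℝ (Fin n))) =
      T ⁻¹' (Set.Ioo (0 : ℝ) 1 • ((↑) '' s)) := by
    ext y
    simp only [Set.mem_smul, Set.mem_image, Set.mem_preimage]
    constructor
    · rintro ⟨r, hr, _, ⟨x, hx, rfl⟩, rfl⟩
      exact ⟨r, hr, _, ⟨_, hx, rfl⟩, by simp [rotate]⟩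
    · rintro ⟨r, hr, _, ⟨x, hx, rfl⟩, h⟩
      refine ⟨r, hr, _, ⟨rotate T.symm x, ?_, rfl⟩, ?_⟩
      · simpa [rotate] using hx
      · apply T.injective
        simpa [rotate] using h
  rw [h, T.measurePreserving.measure_preimage_emb T.toHomeomorph.measurableEmbedding]

theorem exists_rotate_eq {n : ℕ} (x y : Sphere n) :
    ∃ T : EuclideanSpace ℝ (Fin n) ≃ₗᵢ[ℝ] EuclideanSpace ℝ (Fin n), rotate T x = y :=
  ⟨_, Subtype.ext (Submodule.reflection_sub (by simp))⟩

variable {m n : ℕ}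

theorem onSphere_add (p q : MvPolynomial (Fin n) ℝ) (x : Sphere n) :
    onSphere (p + q) x = onSphere p x + onSphere q x := by
  simp [onSphere]

theorem onSphere_smul (c : ℝ) (p : MvPolynomial (Fin n) ℝ) (x : Sphere n) :
    onSphere (c • p) x = c * onSphere p x := by
  simp [onSphere]

theorem onSphere_pow (p : MvPolynomial (Fin n) ℝ) (j : ℕ) (x : Sphere n) :
    onSphere (p ^ j) x = onSphere p x ^ j := by
  simp [onSphere]

/-- The forms of mean zero are stable under composition with an isometry. -/
theorem exists_onSphere_rotate
    (T : EuclideanSpace ℝ (Fin n) ≃ₗᵢ[ℝ] EuclideanSpace ℝ (Fin n)) (u : U m n) :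
    ∃ v : U m n, ∀ x, onSphere v.toPoly x = onSphere u.toPoly (rotate T x) := by
  -- `L i` is the `i`-th coordinate of `T x` as a linear form, so `q` is `u ∘ T`.
  let L : Fin n → MvPolynomial (Fin n) ℝ := fun i =>
    ∑ j, MvPolynomial.C (T (EuclideanSpace.single j 1) i) * MvPolynomial.X j
  let q := MvPolynomial.aeval L u.toPoly
  have hL : ∀ i, (L i).IsHomogeneous 1 := fun i =>
    MvPolynomial.IsHomogeneous.sum _ _ _ fun j _ => MvPolynomial.isHomogeneous_C_mul_X _ _
  have hq : ∀ x, onSphere q x = onSphere u.toPoly (rotate T x) := by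
    intro x
    have hx : ∀ i, MvPolynomial.eval (x : EuclideanSpace ℝ (Fin n)).ofLp (L i) =
        (T (x : EuclideanSpace ℝ (Fin n))) i := by
      intro i
      have h := congrArg (fun y => T y i)
        ((EuclideanSpace.basisFun (Fin n) ℝ).sum_repr (x : EuclideanSpace ℝ (Fin n)))
      simp only [map_sum, map_smul] at h
      rw [← h]
      simp [L, mul_comm]
    have h := MvPolynomial.comp_aeval_apply (f := L)
      (MvPolynomial.aeval (R := ℝ) (x : EuclideanSpace ℝ (Fin n)).ofLp) u.toPoly
    have hev : ∀ (y : Fin n → ℝ) (p : MvPolynomial (Fin n) ℝ),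
        MvPolynomial.aeval (R := ℝ) y p = MvPolynomial.eval y p := fun _ _ => rfl
    simp only [hev, hx] at h
    exact h
  refine ⟨⟨q, ?_, ?_⟩, hq⟩
  · have := u.isHomogeneous.aeval L hL
    rwa [one_mul] at this
  · simp_rw [hq]
    have hc : Continuous (rotate T) := by
      unfold rotate
      fun_prop
    rw [← integral_map (φ := rotate T) hc.aemeasurable
      (continuous_onSphere u.toPoly).aestronglyMeasurable, (measurePreserving_rotate T).map_eq]
    exact u.2.2

variable [NeZero n]

theorem inner_eq_integral (u v : U m n) :
    inner ℝ u v = ∫ x, onSphere u.toPoly x * onSphere v.toPoly x ∂(sphereMeasure n) := rfl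

theorem norm_sq_eq_integral (u : U m n) :
    ‖u‖ ^ 2 = ∫ x, onSphere u.toPoly x ^ 2 ∂(sphereMeasure n) := by
  rw [← real_inner_self_eq_norm_sq, inner_eq_integral]
  simp_rw [sq]

/-- Evaluation at a point of the sphere, as a linear functional on `U m n`. -/
noncomputable def evalAt (x : Sphere n) : U m n →L[ℝ] ℝ :=
  LinearMap.toContinuousLinearMap
    { toFun := fun u => onSphere u.toPoly x
      map_add' := fun u v => by rw [map_add, onSphere_add]
      map_smul' := fun c u => by rw [map_smul, onSphere_smul]; rfl }

@[simp]
theorem evalAt_apply (x : Sphere n) (u : U m n) : evalAt x u = onSphere u.toPoly x := rfl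

/-- The vector representing evaluation at a point. -/
noncomputable def kernelAt (m : ℕ) (x : Sphere n) : U m n :=
  (InnerProductSpace.toDual ℝ (U m n)).symm (evalAt x)

@[simp]
theorem inner_kernelAt (x : Sphere n) (u : U m n) :
    inner ℝ (kernelAt m x) u = onSphere u.toPoly x := by
  rw [kernelAt, InnerProductSpace.toDual_symm_apply, evalAt_apply]

/-- Composing the kernel at `T x` with `T` gives `v` of the same norm, and pairing `v` with the
kernel at `x` gives the squared norm of the kernel at `T x`. Cauchy–Schwarz concludes. -/
theorem norm_kernelAt_rotate_le
    (T : EuclideanSpace ℝ (Fin n) ≃ₗᵢ[ℝ] EuclideanSpace ℝ (Fin n)) (x : Sphere n) :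
    ‖kernelAt m (rotate T x)‖ ≤ ‖kernelAt m x‖ := by
  obtain ⟨v, hv⟩ := exists_onSphere_rotate T (kernelAt m (rotate T x))
  have hn : ‖v‖ = ‖kernelAt m (rotate T x)‖ := by
    rw [← sq_eq_sq₀ (norm_nonneg _) (norm_nonneg _), norm_sq_eq_integral, norm_sq_eq_integral]
    simp_rw [hv]
    have hm := measurePreserving_rotate T
    rw [← integral_map (φ := rotate T) (f := fun y => onSphere (kernelAt m (rotate T x)).toPoly y ^ 2)
      hm.measurable.aemeasurable
      ((continuous_onSphere _).pow 2).aestronglyMeasurable, hm.map_eq]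
  have h1 : ‖kernelAt m (rotate T x)‖ ^ 2 = inner ℝ (kernelAt m x) v := by
    rw [inner_kernelAt, hv, ← inner_kernelAt, real_inner_self_eq_norm_sq]
  have h2 := real_inner_le_norm (kernelAt m x) v
  rw [← h1, hn, sq] at h2
  by_contra! h
  have := (norm_nonneg _).trans_lt h
  nlinarith

/-- By transitivity of rotations the norm does not depend on `x`. Its square is the sum of the
squared values of an orthonormal basis, which integrates to the number of basis vectors. -/
theorem norm_kernelAt_sq (x : Sphere n) :
    ‖kernelAt m x‖ ^ 2 = Module.finrank ℝ (U m n) := by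
  have hconst : ∀ y : Sphere n, ‖kernelAt m y‖ = ‖kernelAt m x‖ := by
    intro y
    obtain ⟨S, hS⟩ := exists_rotate_eq x y
    obtain ⟨T, hT⟩ := exists_rotate_eq y x
    refine le_antisymm ?_ ?_
    · rw [← hS]; exact norm_kernelAt_rotate_le S x
    · conv_lhs => rw [← hT]
      exact norm_kernelAt_rotate_le T y
  let b := stdOrthonormalBasis ℝ (U m n)
  have hb : ∀ y : Sphere n, ‖kernelAt m y‖ ^ 2 = ∑ i, onSphere (b i).toPoly y ^ 2 := by
    intro y
    rw [← b.sum_sq_norm_inner_left (kernelAt m y)]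
    simp
  have h : ∫ y, ‖kernelAt m y‖ ^ 2 ∂(sphereMeasure n) = Module.finrank ℝ (U m n) := by
    simp_rw [hb]
    rw [integral_finsetSum]
    · simp_rw [← norm_sq_eq_integral]
      simp
    · exact fun i _ => integrable_of_continuous ((continuous_onSphere _).pow 2)
  simpa [hconst] using h

theorem onSphere_sq_le (u : U m n) (x : Sphere n) :
    onSphere u.toPoly x ^ 2 ≤ Module.finrank ℝ (U m n) * ‖u‖ ^ 2 := by
  rw [← norm_kernelAt_sq (m := m) x, ← inner_kernelAt, ← mul_pow, sq_le_sq,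
    abs_of_nonneg (mul_nonneg (norm_nonneg _) (norm_nonneg _))]
  exact abs_real_inner_le_norm _ _

end NonnegForms

/-! ### Sphere values, boundedness of `Pos'`, sup norm against `L²` norm -/

namespace NonnegForms

variable {k n : ℕ}

theorem isHomogeneous_sumSq_pow (k n : ℕ) :
    ((∑ i, MvPolynomial.X i ^ 2 : MvPolynomial (Fin n) ℝ) ^ k).IsHomogeneous (2 * k) :=
  (MvPolynomial.IsHomogeneous.sum _ _ _ fun i _ => MvPolynomial.isHomogeneous_X_pow i 2).pow k

@[simp]
theorem onSphere_sumSq_pow (k : ℕ) (x : Sphere n) :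
    onSphere ((∑ i, MvPolynomial.X i ^ 2 : MvPolynomial (Fin n) ℝ) ^ k) x = 1 := by
  have h : ∑ i, (x : EuclideanSpace ℝ (Fin n)).ofLp i ^ 2 = 1 := by
    rw [← EuclideanSpace.real_norm_sq_eq]
    simp
  simp [onSphere, h]

theorem eval_nonneg_of_onSphere {m : ℕ} (hm : m ≠ 0) {p : MvPolynomial (Fin n) ℝ}
    (hp : p.IsHomogeneous m) (h : ∀ x, 0 ≤ onSphere p x) (y : Fin n → ℝ) :
    0 ≤ MvPolynomial.eval y p := by
  let z : EuclideanSpace ℝ (Fin n) := WithLp.toLp 2 y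
  by_cases hz : z = 0
  · have hy : y = (0 : ℝ) • y := by
      rw [zero_smul]
      exact congrArg WithLp.ofLp hz
    rw [hy, eval_smul_of_isHomogeneous hp, zero_pow hm, zero_mul]
  · have hn : ‖z‖ ≠ 0 := norm_ne_zero_iff.2 hz
    have hy : y = ‖z‖ • (‖z‖⁻¹ • z).ofLp := by
      rw [← WithLp.ofLp_smul, smul_inv_smul₀ hn]
    rw [hy, eval_smul_of_isHomogeneous hp]
    exact mul_nonneg (by positivity) (h ⟨‖z‖⁻¹ • z, by simp [norm_smul, hn]⟩)

@[simp]
theorem integral_onSphere {m n : ℕ} (u : U m n) :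
    ∫ x, onSphere u.toPoly x ∂(sphereMeasure n) = 0 := u.2.2

variable [NeZero n]

theorem mem_Pos'_of_neg_one_le (hk : k ≠ 0) {u : U (2 * k) n}
    (hu : ∀ x, -1 ≤ onSphere u.toPoly x) : u ∈ Pos' k n := by
  refine ⟨u.toPoly + (∑ i, MvPolynomial.X i ^ 2) ^ k, ⟨?_, ?_, ?_⟩, by simp⟩
  · exact u.isHomogeneous.add (isHomogeneous_sumSq_pow k n)
  · refine eval_nonneg_of_onSphere (by omega)
      (u.isHomogeneous.add (isHomogeneous_sumSq_pow k n)) fun x => ?_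
    rw [onSphere_add, onSphere_sumSq_pow]
    linarith [hu x]
  · simp_rw [onSphere_add, onSphere_sumSq_pow]
    rw [integral_add (integrable_of_continuous (continuous_onSphere _)) (integrable_const 1)]
    simp

/-- Integrating `u ≤ √d ‖u‖` against the probability density `u + 1 ≥ 0` gives `‖u‖ ^ 2 ≤ √d ‖u‖`.
-/
theorem norm_sq_le_of_mem_Pos' {u : U (2 * k) n} (hu : u ∈ Pos' k n) :
    ‖u‖ ^ 2 ≤ Module.finrank ℝ (U (2 * k) n) := by
  obtain ⟨p, ⟨-, hp, -⟩, hup⟩ := hu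
  have hpos : ∀ x : Sphere n, 0 ≤ onSphere u.toPoly x + 1 := by
    intro x
    have h : onSphere p x = onSphere u.toPoly x + 1 := by
      rw [← onSphere_sumSq_pow k x, ← onSphere_add, hup, sub_add_cancel]
    rw [← h]
    exact hp _
  set s := √(Module.finrank ℝ (U (2 * k) n) : ℝ) with hs
  have hs2 : s ^ 2 = Module.finrank ℝ (U (2 * k) n) := Real.sq_sqrt (by positivity)
  have hs0 : 0 ≤ s := Real.sqrt_nonneg _
  have hle : ∀ x : Sphere n, onSphere u.toPoly x ≤ s * ‖u‖ := fun x =>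
    le_of_sq_le_sq (by rw [mul_pow, hs2]; exact onSphere_sq_le u x) (by positivity)
  have hc := continuous_onSphere u.toPoly
  have h1 : ∫ x, onSphere u.toPoly x * (onSphere u.toPoly x + 1) ∂(sphereMeasure n) ≤
      ∫ x, s * ‖u‖ * (onSphere u.toPoly x + 1) ∂(sphereMeasure n) :=
    integral_mono (integrable_of_continuous (by fun_prop)) (integrable_of_continuous (by fun_prop))
      fun x => mul_le_mul_of_nonneg_right (hle x) (hpos x)
  have h2 : ∫ x, onSphere u.toPoly x * (onSphere u.toPoly x + 1) ∂(sphereMeasure n) = ‖u‖ ^ 2 := by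
    rw [norm_sq_eq_integral]
    simp_rw [mul_add, mul_one, ← sq]
    rw [integral_add (integrable_of_continuous (by fun_prop)) (integrable_of_continuous hc)]
    simp
  have h3 : ∫ x, s * ‖u‖ * (onSphere u.toPoly x + 1) ∂(sphereMeasure n) = s * ‖u‖ := by
    rw [integral_const_mul, integral_add (integrable_of_continuous hc) (integrable_const 1)]
    simp
  rw [h2, h3] at h1
  rw [← hs2]
  have : ‖u‖ ≤ s := by
    by_contra! h
    nlinarith [norm_nonneg u]
  gcongr

/-- Needed because `volume.real` takes the value `0` on sets of infinite measure. -/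
theorem measure_Pos'_ne_top (k n : ℕ) [NeZero n] : volume (Pos' k n) ≠ ⊤ := by
  refine measure_ne_top_of_subset (s := Metric.closedBall (0 : U (2 * k) n)
    √(Module.finrank ℝ (U (2 * k) n) : ℝ)) (fun u hu => ?_)
    (measure_closedBall_lt_top (μ := volume)).ne
  rw [mem_closedBall_zero_iff]
  exact Real.le_sqrt_of_sq_le (norm_sq_le_of_mem_Pos' hu)

/-- The sup norm of a form of even degree is at most the square root of the dimension times its
`L²` norm. -/
theorem onSphere_sq_le_of_isHomogeneous {g : MvPolynomial (Fin n) ℝ}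
    (hg : g.IsHomogeneous (2 * k)) (x : Sphere n) :
    onSphere g x ^ 2 ≤ (Module.finrank ℝ (U (2 * k) n) + 1) *
      ∫ y, onSphere g y ^ 2 ∂(sphereMeasure n) := by
  -- Orthogonal splitting of `g` into a mean-zero form and a multiple of `(∑ x_i²)^k`; the latter
  -- accounts for the `+ 1`.
  set c := ∫ y, onSphere g y ∂(sphereMeasure n)
  have hgc := continuous_onSphere g
  have hu : ∀ y : Sphere n, onSphere (g + (-c) • (∑ i, MvPolynomial.X i ^ 2) ^ k) y =
      onSphere g y - c := by
    intro y
    rw [onSphere_add, onSphere_smul, onSphere_sumSq_pow]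
    ring
  let u : U (2 * k) n := ⟨g + (-c) • (∑ i, MvPolynomial.X i ^ 2) ^ k,
    hg.add ((MvPolynomial.homogeneousSubmodule (Fin n) ℝ (2 * k)).smul_mem _
      (isHomogeneous_sumSq_pow k n)), by
    simp_rw [hu]
    rw [integral_sub (integrable_of_continuous hgc) (integrable_const c)]
    simp [c]⟩
  replace hu : ∀ y, onSphere u.toPoly y = onSphere g y - c := hu
  have hg' : ∀ y, onSphere g y = onSphere u.toPoly y + c := fun y => by rw [hu]; ring
  have huc := continuous_onSphere u.toPoly
  have hint : ∫ y, onSphere g y ^ 2 ∂(sphereMeasure n) = ‖u‖ ^ 2 + c ^ 2 := by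
    simp_rw [hg', add_sq]
    rw [integral_add (integrable_of_continuous (by fun_prop)) (integrable_const _),
      integral_add (integrable_of_continuous (by fun_prop))
        (integrable_of_continuous (by fun_prop)), ← norm_sq_eq_integral, integral_mul_const,
      integral_const_mul]
    simp
  rw [hint, hg' x]
  have h := onSphere_sq_le u x
  set D : ℝ := (Module.finrank ℝ (U (2 * k) n) : ℝ)
  set a := onSphere u.toPoly x
  have hD : 0 ≤ D := Nat.cast_nonneg _
  set s := √D with hs
  have hs2 : s ^ 2 = D := Real.sq_sqrt hD
  have h' : |a| ≤ s * ‖u‖ := abs_le_of_sq_le_sq (by rw [mul_pow, hs2]; exact h)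
    (mul_nonneg (Real.sqrt_nonneg _) (norm_nonneg _))
  have h3 : (|a| + |c|) ^ 2 ≤ (s * ‖u‖ + |c|) ^ 2 := by gcongr
  have h4 : (a + c) ^ 2 ≤ (|a| + |c|) ^ 2 := by
    rw [← sq_abs (a + c)]
    gcongr
    exact abs_add_le a c
  rw [← hs2]
  -- Cauchy–Schwarz for `(s, 1)` and `(‖u‖, |c|)`; the hinted square is the exact defect.
  nlinarith [sq_nonneg (‖u‖ - s * |c|), sq_abs c]

end NonnegForms

/-! ### Dimension count -/

namespace NonnegForms

theorem finrank_homogeneousSubmodule (m n : ℕ) :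
    Module.finrank ℝ (MvPolynomial.homogeneousSubmodule (Fin n) ℝ m) = (n + m - 1).choose m := by
  rw [MvPolynomial.homogeneousSubmodule_eq_finsupp_supported]
  have hset : {d : Fin n →₀ ℕ | d.degree = m} =
      (Finset.univ.finsuppAntidiag m : Finset (Fin n →₀ ℕ)) := by
    ext d
    simp [Finset.mem_finsuppAntidiag, Finsupp.degree_eq_sum]
  refine (Module.finrank_eq_nat_card_basis (MvPolynomial.basisRestrictSupport ℝ
    {d : Fin n →₀ ℕ | d.degree = m})).trans ?_
  rw [hset, Nat.card_coe_set_eq, Set.ncard_coe_finset,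
    Finset.card_finsuppAntidiag_nat_eq_choose, Finset.card_univ, Fintype.card_fin]

/-- `U` is the kernel of the mean functional, nonzero because `(∑ x_i²)^k` has mean `1`. -/
theorem finrank_U (k n : ℕ) [NeZero n] :
    Module.finrank ℝ (U (2 * k) n) = (n + 2 * k - 1).choose (2 * k) - 1 := by
  let H := MvPolynomial.homogeneousSubmodule (Fin n) ℝ (2 * k)
  have : FiniteDimensional ℝ H :=
    Module.Finite.iff_fg.2 (MvPolynomial.homogeneousSubmodule_fg _ _ _)
  let φ : H →ₗ[ℝ] ℝ :=
    { toFun := fun p => ∫ x, onSphere p.1 x ∂(sphereMeasure n)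
      map_add' := fun p q => by
        simp_rw [Submodule.coe_add, onSphere_add]
        exact integral_add (integrable_of_continuous (continuous_onSphere _))
          (integrable_of_continuous (continuous_onSphere _))
      map_smul' := fun c p => by
        simp_rw [Submodule.coe_smul, onSphere_smul]
        exact integral_const_mul _ _ }
  have hφ : φ ≠ 0 := by
    intro h
    have h1 := LinearMap.congr_fun h ⟨_, isHomogeneous_sumSq_pow k n⟩
    simp [φ] at h1
  let e : U (2 * k) n ≃ₗ[ℝ] LinearMap.ker φ :=
    { toFun := fun u => ⟨⟨u.toPoly, u.isHomogeneous⟩, u.2.2⟩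
      invFun := fun p => ⟨p.1.1, p.1.2, p.2⟩
      map_add' := fun _ _ => rfl
      map_smul' := fun _ _ => rfl
      left_inv := fun _ => rfl
      right_inv := fun _ => rfl }
  have h := Module.Dual.finrank_ker_add_one_of_ne_zero hφ
  rw [finrank_homogeneousSubmodule] at h
  rw [e.finrank_eq]
  omega

end NonnegForms

/-! ### Caps and moments on a Euclidean ball -/

namespace NonnegForms

section Ball

variable {E : Type*} [NormedAddCommGroup E] [InnerProductSpace ℝ E] [FiniteDimensional ℝ E]
  [MeasurableSpace E] [BorelSpace E] (μ : Measure E) [μ.IsAddHaarMeasure]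

/-- Concentration of measure for the unit ball: a cap is contained in a smaller ball. -/
theorem measure_cap_le {w : E} (hw : ‖w‖ ^ 2 ≤ Module.finrank ℝ E) {t : ℝ} (ht : 0 < t) :
    μ (Metric.closedBall 0 1 ∩ {v | t ≤ inner ℝ w v}) ≤
      ENNReal.ofReal (Real.exp (-(1 / 2) * t ^ 2)) * μ (Metric.closedBall 0 1) := by
  set d : ℝ := (Module.finrank ℝ E : ℝ) with hd
  have hd0 : 0 ≤ d := Nat.cast_nonneg _
  rcases hd0.eq_or_lt with h0 | h0
  · have hw0 : w = 0 := by
      rw [← h0] at hw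
      simpa using le_antisymm hw (by positivity)
    have : Metric.closedBall (0 : E) 1 ∩ {v | t ≤ inner ℝ w v} = ∅ := by
      ext v
      simp [hw0, ht]
    simp [this]
  -- For `v` in the cap, `‖v - (t/d) w‖² ≤ 1 - 2t²/d + t²/d`.
  have hsub : Metric.closedBall (0 : E) 1 ∩ {v | t ≤ inner ℝ w v} ⊆
      Metric.closedBall ((t / d) • w) √(1 - t ^ 2 / d) := by
    rintro v ⟨hv, hvt⟩
    rw [mem_closedBall_zero_iff] at hv
    rw [mem_closedBall_iff_norm, ← abs_of_nonneg (norm_nonneg _)]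
    refine Real.abs_le_sqrt ?_
    rw [norm_sub_sq_real, real_inner_smul_right, norm_smul, mul_pow, Real.norm_eq_abs, sq_abs,
      real_inner_comm]
    have h1 : ‖v‖ ^ 2 ≤ 1 := pow_le_one₀ (norm_nonneg _) hv
    have h2 : t / d * t ≤ t / d * inner ℝ w v := by
      gcongr
      exact hvt
    have h3 : (t / d) ^ 2 * ‖w‖ ^ 2 ≤ (t / d) ^ 2 * d := by gcongr
    have h4 : (t / d) ^ 2 * d = t ^ 2 / d := by field_simp
    have h5 : t / d * t = t ^ 2 / d := by ring
    linarith
  refine (measure_mono hsub).trans ?_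
  rw [Measure.addHaar_closedBall' μ _ (Real.sqrt_nonneg _)]
  gcongr
  have h1 : √(1 - t ^ 2 / d) ≤ Real.exp (-(t ^ 2 / d) / 2) := by
    rw [Real.exp_half]
    refine Real.sqrt_le_sqrt ?_
    linarith [Real.add_one_le_exp (-(t ^ 2 / d))]
  refine (pow_le_pow_left₀ (Real.sqrt_nonneg _) h1 _).trans_eq ?_
  rw [← Real.exp_nat_mul]
  congr 1
  rw [← hd]
  field_simp

theorem measure_double_cap_le {w : E} (hw : ‖w‖ ^ 2 ≤ Module.finrank ℝ E) {t : ℝ} (ht : 0 < t) :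
    μ.restrict (Metric.closedBall 0 1) {v | t ≤ |inner ℝ w v|} ≤
      2 * μ (Metric.closedBall 0 1) * ENNReal.ofReal (Real.exp (-(1 / 2) * t ^ 2)) := by
  have hsub : {v | t ≤ |inner ℝ w v|} ∩ Metric.closedBall (0 : E) 1 ⊆
      (Metric.closedBall 0 1 ∩ {v | t ≤ inner ℝ w v}) ∪
        (Metric.closedBall 0 1 ∩ {v | t ≤ inner ℝ (-w) v}) := by
    rintro v ⟨h1, h2⟩
    rcases le_abs.1 (show t ≤ |inner ℝ w v| from h1) with h | h
    · exact Or.inl ⟨h2, h⟩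
    · exact Or.inr ⟨h2, by simpa [inner_neg_left] using h⟩
  rw [Measure.restrict_apply' Metric.isClosed_closedBall.measurableSet]
  refine (measure_mono hsub).trans ((measure_union_le _ _).trans ?_)
  refine (add_le_add (measure_cap_le μ hw ht)
    (measure_cap_le μ (w := -w) (by rwa [norm_neg]) ht)).trans_eq ?_
  ring

/-- Moments of a linear functional on the unit ball. -/
theorem lintegral_inner_pow_le {w : E} (hw : ‖w‖ ^ 2 ≤ Module.finrank ℝ E) {p : ℕ} (hp : 0 < p) :
    ∫⁻ v in Metric.closedBall 0 1, ENNReal.ofReal (inner ℝ w v ^ (2 * p)) ∂μ ≤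
      ENNReal.ofReal (2 * 2 ^ p * p.factorial) * μ (Metric.closedBall 0 1) := by
  have hp' : (0 : ℝ) < p := Nat.cast_pos.2 hp
  have hc : Continuous fun v : E => |inner ℝ w v| := by fun_prop
  -- Layer-cake formula; the tail bound reduces the moment to a Gaussian integral, a value of `Γ` at
  -- `p`.
  have h := lintegral_rpow_eq_lintegral_meas_le_mul (μ.restrict (Metric.closedBall 0 1))
    (f := fun v => |inner ℝ w v|) (Filter.Eventually.of_forall fun _ => abs_nonneg _)
    hc.aemeasurable (p := ((2 * p : ℕ) : ℝ)) (by positivity)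
  simp_rw [Real.rpow_natCast, (even_two_mul p).pow_abs] at h
  rw [h]
  have hle : ∫⁻ t in Set.Ioi 0, μ.restrict (Metric.closedBall 0 1) {v | t ≤ |inner ℝ w v|} *
        ENNReal.ofReal (t ^ (((2 * p : ℕ) : ℝ) - 1)) ≤
      ∫⁻ t in Set.Ioi 0, 2 * μ (Metric.closedBall 0 1) *
        ENNReal.ofReal (t ^ (((2 * p : ℕ) : ℝ) - 1) * Real.exp (-(1 / 2) * t ^ (2 : ℝ))) := by
    refine setLIntegral_mono' measurableSet_Ioi fun t ht => ?_
    rw [mul_comm (t ^ _), ENNReal.ofReal_mul (Real.exp_pos _).le, ← mul_assoc, Real.rpow_two]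
    gcongr
    exact measure_double_cap_le μ hw ht
  have hq : -1 < (((2 * p : ℕ) : ℝ) - 1) := by push_cast; linarith
  have hint : IntegrableOn (fun t : ℝ => t ^ (((2 * p : ℕ) : ℝ) - 1) *
      Real.exp (-(1 / 2) * t ^ (2 : ℝ))) (Set.Ioi 0) := by
    simp_rw [Real.rpow_two]
    exact integrableOn_rpow_mul_exp_neg_mul_sq (by norm_num) hq
  have hval : ∫ t in Set.Ioi (0 : ℝ), t ^ (((2 * p : ℕ) : ℝ) - 1) *
      Real.exp (-(1 / 2) * t ^ (2 : ℝ)) = 2 ^ p * (1 / 2) * (p - 1).factorial := by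
    rw [integral_rpow_mul_exp_neg_mul_rpow (by norm_num) hq (by norm_num)]
    have h1 : (((2 * p : ℕ) : ℝ) - 1 + 1) / 2 = ((p - 1 : ℕ) : ℝ) + 1 := by
      rw [Nat.cast_sub hp]
      push_cast
      ring
    have h2 : -(((2 * p : ℕ) : ℝ) - 1 + 1) / 2 = -(p : ℝ) := by
      push_cast
      ring
    rw [h1, h2, Real.Gamma_nat_eq_factorial, Real.rpow_neg (by norm_num), Real.rpow_natCast]
    simp
  rw [lintegral_const_mul' _ _ (ENNReal.mul_ne_top ENNReal.ofNat_ne_top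
    measure_closedBall_lt_top.ne), ← ofReal_integral_eq_lintegral_ofReal hint ?_, hval] at hle
  · refine (mul_le_mul_right hle _).trans_eq ?_
    obtain ⟨q, rfl⟩ : ∃ q, p = q + 1 := ⟨p - 1, by omega⟩
    rw [show (2 : ENNReal) = ENNReal.ofReal 2 by simp, mul_right_comm, ← mul_assoc,
      ← ENNReal.ofReal_mul (by norm_num), ← ENNReal.ofReal_mul (by positivity)]
    congr 2
    rw [Nat.factorial_succ, Nat.add_sub_cancel]
    push_cast
    ring
  · refine (ae_restrict_mem measurableSet_Ioi).mono fun t ht => ?_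
    have : (0 : ℝ) < t := ht
    simp only [Pi.zero_apply]
    positivity

end Ball

end NonnegForms

/-! ### Sup norm of a typical form and the volume bound -/

namespace NonnegForms

theorem one_le_log_two_mul_add_one {k : ℕ} (hk : 1 ≤ k) : 1 ≤ Real.log (2 * (k : ℝ) + 1) := by
  have hk' : (1 : ℝ) ≤ k := by exact_mod_cast hk
  rw [Real.le_log_iff_exp_le (by positivity)]
  linarith [Real.exp_one_lt_three]

/-- The dimension of the space of forms of degree `2kp` in `n` variables is at most exponential
in `p` once `p ≥ n ln (2k + 1)`. -/
theorem choose_le_exp {n k p : ℕ} (hn : 1 ≤ n) (hk : 1 ≤ k)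
    (hp : n * Real.log (2 * (k : ℝ) + 1) ≤ p) :
    ((n + 2 * (k * p) - 1).choose (2 * (k * p)) : ℝ) ≤ Real.exp (2 * p) := by
  obtain ⟨r, rfl⟩ : ∃ r, n = r + 1 := ⟨n - 1, by omega⟩
  set L := Real.log (2 * (k : ℝ) + 1) with hL
  have hL1 : 1 ≤ L := one_le_log_two_mul_add_one hk
  have hrp : (r : ℝ) * L ≤ p := by
    push_cast at hp
    nlinarith
  have hr : (r : ℝ) ≤ p := by nlinarith [Nat.cast_nonneg (α := ℝ) r]
  set c : ℝ := 2 * (k : ℝ) + 1 with hc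
  have hc0 : 0 < c := by positivity
  rw [show r + 1 + 2 * (k * p) - 1 = r + 2 * (k * p) by omega, Nat.choose_symm_add.symm]
  set N := r + 2 * (k * p) with hN
  -- A single term of the binomial expansion. With `c = 2k + 1`, `r ≤ p` gives `N / c ≤ p`, and `r
  -- ln c ≤ p` gives `c ^ r ≤ e ^ p`.
  have h1 : c⁻¹ ^ r * (N.choose r : ℝ) ≤ (c⁻¹ + 1) ^ N := by
    rw [add_pow]
    have h := Finset.single_le_sum (f := fun i => c⁻¹ ^ i * 1 ^ (N - i) * (N.choose i : ℝ))
      (s := Finset.range (N + 1)) (fun i _ => by positivity) (a := r)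
      (Finset.mem_range.2 (by omega))
    simpa using h
  have h2 : (c⁻¹ + 1) ^ N ≤ Real.exp p := by
    calc (c⁻¹ + 1) ^ N ≤ Real.exp c⁻¹ ^ N := by
          gcongr
          exact Real.add_one_le_exp _
      _ = Real.exp (N * c⁻¹) := (Real.exp_nat_mul _ _).symm
      _ ≤ Real.exp p := by
          gcongr
          rw [← div_eq_mul_inv, div_le_iff₀ hc0, hN, hc]
          push_cast
          nlinarith
  have h3 : c ^ r ≤ Real.exp p := by
    rw [← Real.exp_log hc0, ← Real.exp_nat_mul]
    gcongr
  calc (N.choose r : ℝ) = c ^ r * (c⁻¹ ^ r * N.choose r) := by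
        rw [inv_pow, mul_inv_cancel_left₀ (by positivity)]
    _ ≤ Real.exp p * Real.exp p := by
        gcongr
        exact h1.trans h2
    _ = Real.exp (2 * p) := by rw [← Real.exp_add, two_mul]

variable {k m n : ℕ} [NeZero n]

theorem continuous_onSphere_uncurry :
    Continuous fun z : U m n × Sphere n => onSphere z.1.toPoly z.2 := by
  let b := stdOrthonormalBasis ℝ (U m n)
  have h : (fun z : U m n × Sphere n => onSphere z.1.toPoly z.2) =
      fun z => ∑ i, inner ℝ (b i) z.1 * onSphere (b i).toPoly z.2 := by
    ext ⟨u, x⟩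
    have hu := congrArg (evalAt x) (b.sum_repr' u)
    simpa using hu.symm
  rw [h]
  have hb := fun i => continuous_onSphere (b i).toPoly
  fun_prop

theorem lintegral_lintegral_onSphere_pow_le {p : ℕ} (hp : 0 < p) :
    ∫⁻ u in Metric.closedBall (0 : U m n) 1,
        ∫⁻ x, ENNReal.ofReal (onSphere u.toPoly x ^ (2 * p)) ∂(sphereMeasure n) ≤
      ENNReal.ofReal (2 * 2 ^ p * p.factorial) * volume (Metric.closedBall (0 : U m n) 1) := by
  have hc := continuous_onSphere_uncurry (m := m) (n := n)
  rw [lintegral_lintegral_swap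
    (f := fun (u : U m n) (x : Sphere n) => ENNReal.ofReal (onSphere u.toPoly x ^ (2 * p)))
    (by
      refine Measurable.aemeasurable (Measurable.ennreal_ofReal ?_)
      exact (hc.pow (2 * p)).measurable)]
  calc _ ≤ ∫⁻ _, ENNReal.ofReal (2 * 2 ^ p * p.factorial) *
          volume (Metric.closedBall (0 : U m n) 1) ∂(sphereMeasure n) := by
        refine lintegral_mono fun x => ?_
        have h := lintegral_inner_pow_le volume (norm_kernelAt_sq (m := m) x).le hp
        simpa using h
    _ = _ := by simp

/-- The sup-norm bound for `u ^ p`, whose squared `L²` norm is `∫ u ^ (2p)`. -/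
theorem onSphere_pow_le (u : U (2 * k) n) (p : ℕ) (x : Sphere n) :
    onSphere u.toPoly x ^ (2 * p) ≤ (n + 2 * (k * p) - 1).choose (2 * (k * p)) *
      ∫ y, onSphere u.toPoly y ^ (2 * p) ∂(sphereMeasure n) := by
  have hg : (u.toPoly ^ p).IsHomogeneous (2 * (k * p)) := by
    rw [← mul_assoc]
    exact u.isHomogeneous.pow p
  have h := onSphere_sq_le_of_isHomogeneous hg x
  have hn := NeZero.pos n
  have hpos : 0 < (n + 2 * (k * p) - 1).choose (2 * (k * p)) := Nat.choose_pos (by omega)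
  have hd : (Module.finrank ℝ (U (2 * (k * p)) n) : ℝ) + 1 =
      (n + 2 * (k * p) - 1).choose (2 * (k * p)) := by
    rw [finrank_U]
    exact_mod_cast Nat.sub_add_cancel hpos
  simpa only [onSphere_pow, ← pow_mul, mul_comm p 2, hd] using h

/-- At least half of the unit ball of `U` consists of forms of sup norm at most
`e * √(8p)`. -/
theorem volume_closedBall_le_two_mul {p : ℕ} (hk : 1 ≤ k)
    (hp : n * Real.log (2 * (k : ℝ) + 1) ≤ p) :
    volume (Metric.closedBall (0 : U (2 * k) n) 1) ≤
      2 * volume {u : U (2 * k) n | ∀ x, onSphere u.toPoly x ^ 2 ≤ Real.exp 2 * 8 * p} := by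
  have hn := NeZero.pos n
  have hp0 : 0 < p := by
    have h1 := one_le_log_two_mul_add_one hk
    have h2 : (1 : ℝ) ≤ n := by exact_mod_cast hn
    have : (0 : ℝ) < p := by nlinarith
    exact_mod_cast this
  set B := Metric.closedBall (0 : U (2 * k) n) 1
  set F : U (2 * k) n → ENNReal := fun u =>
    ∫⁻ x, ENNReal.ofReal (onSphere u.toPoly x ^ (2 * p)) ∂(sphereMeasure n)
  set a : ℝ := 2 * 2 ^ p * p.factorial with ha
  have ha0 : 0 < a := by positivity
  have hFm : Measurable F := by
    refine Measurable.lintegral_prod_right' (f := fun z : U (2 * k) n × Sphere n =>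
      ENNReal.ofReal (onSphere z.1.toPoly z.2 ^ (2 * p))) (Measurable.ennreal_ofReal ?_)
    exact (continuous_onSphere_uncurry.pow (2 * p)).measurable
  -- The threshold is twice the bound on the mean, so by Markov `S` fills at most half of `B`.
  set S : Set (U (2 * k) n) := {u | 2 * ENNReal.ofReal a ≤ F u}
  have hmarkov : 2 * ENNReal.ofReal a * volume.restrict B S ≤
      ENNReal.ofReal a * volume B :=
    (mul_meas_ge_le_lintegral hFm _).trans (lintegral_lintegral_onSphere_pow_le hp0)
  have ha1 : ENNReal.ofReal a ≠ 0 := by simpa using ha0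
  rw [mul_comm 2, mul_assoc, ENNReal.mul_le_mul_iff_right ha1 ENNReal.ofReal_ne_top] at hmarkov
  have hcompl := measure_add_measure_compl (μ := volume.restrict B)
    (measurableSet_le measurable_const hFm : MeasurableSet S)
  rw [Measure.restrict_apply_univ] at hcompl
  have hB : volume B ≠ ⊤ := measure_closedBall_lt_top.ne
  have hgood : volume.restrict B Sᶜ ≤
      volume {u : U (2 * k) n | ∀ x, onSphere u.toPoly x ^ 2 ≤ Real.exp 2 * 8 * p} := by
    refine (Measure.restrict_apply_le _ _).trans (measure_mono fun u hu x => ?_)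
    have hu' : F u < 2 * ENNReal.ofReal a := not_le.1 hu
    have hint : ∫ y, onSphere u.toPoly y ^ (2 * p) ∂(sphereMeasure n) ≤ 2 * a := by
      have heven : ∀ y : Sphere n, 0 ≤ onSphere u.toPoly y ^ (2 * p) := fun y =>
        (even_two_mul p).pow_nonneg _
      rw [integral_eq_lintegral_of_nonneg_ae (Filter.Eventually.of_forall heven)
        ((continuous_onSphere _).pow _).aestronglyMeasurable]
      refine ENNReal.toReal_le_of_le_ofReal (by positivity) ?_
      rw [ENNReal.ofReal_mul (by norm_num), ENNReal.ofReal_ofNat]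
      exact hu'.le
    have hfac : (p.factorial : ℝ) ≤ (p : ℝ) ^ p := by exact_mod_cast p.factorial_le_pow
    -- Absorbs the constant of `2 * a = 4 * 2 ^ p * p!` into the `p`-th power, whence `8 = 4 * 2`.
    have h4 : (4 : ℝ) ≤ 4 ^ p := le_self_pow₀ (by norm_num) hp0.ne'
    have hle : (onSphere u.toPoly x ^ 2) ^ p ≤ (Real.exp 2 * 8 * p) ^ p := by
      rw [← pow_mul]
      calc _ ≤ _ := onSphere_pow_le u p x
        _ ≤ Real.exp (2 * p) * (2 * a) := by
          refine mul_le_mul (choose_le_exp hn hk hp) hint ?_ (Real.exp_pos _).le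
          exact integral_nonneg fun y => (even_two_mul p).pow_nonneg _
        _ = Real.exp 2 ^ p * (4 * 2 ^ p * p.factorial) := by
          rw [mul_comm 2 (p : ℝ), Real.exp_nat_mul, ha]
          ring
        _ ≤ Real.exp 2 ^ p * (4 ^ p * 2 ^ p * p ^ p) := by gcongr
        _ = (Real.exp 2 * 8 * p) ^ p := by
          rw [← mul_pow, ← mul_pow, ← mul_pow]
          ring
    exact le_of_pow_le_pow_left₀ hp0.ne' (by positivity) hle
  refine le_trans ?_ (mul_le_mul_right hgood 2)
  set b := volume.restrict B S
  set g := volume.restrict B Sᶜ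
  have hb : b ≠ ⊤ := ne_top_of_le_ne_top hB (hcompl ▸ le_self_add)
  rw [← hcompl, two_mul, ENNReal.add_le_add_iff_left hb] at hmarkov
  rw [← hcompl, two_mul]
  gcongr

theorem volume_closedBall_le_mul_volume_Pos' (hk : 1 ≤ k) {M : ℝ} (hM : 0 < M) {p : ℕ}
    (hp : n * Real.log (2 * (k : ℝ) + 1) ≤ p) (hpM : Real.exp 2 * 8 * p ≤ M ^ 2) :
    volume (Metric.closedBall (0 : U (2 * k) n) 1) ≤
      2 * (ENNReal.ofReal (M ^ Module.finrank ℝ (U (2 * k) n)) * volume (Pos' k n)) := by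
  refine (volume_closedBall_le_two_mul hk hp).trans ?_
  rw [← abs_of_nonneg (pow_nonneg hM.le _), ← Measure.addHaar_smul]
  gcongr
  intro u hu
  rw [Set.mem_smul_set_iff_inv_smul_mem₀ hM.ne']
  refine mem_Pos'_of_neg_one_le (by omega) fun x => ?_
  have h : |onSphere u.toPoly x| ≤ M := abs_le_of_sq_le_sq ((hu x).trans hpM) hM.le
  rw [map_smul, onSphere_smul, inv_mul_eq_div, le_div_iff₀ hM]
  linarith [neg_le_of_abs_le h]

theorem finrank_U_pos (hn : 2 ≤ n) (hk : 1 ≤ k) : 0 < Module.finrank ℝ (U (2 * k) n) := by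
  rw [finrank_U]
  have h : (2 * k + 1).choose (2 * k) ≤ (n + 2 * k - 1).choose (2 * k) :=
    Nat.choose_le_choose _ (by omega)
  rw [Nat.choose_succ_self_right] at h
  omega

theorem le_volume_ratio (hn : 2 ≤ n) (hk : 1 ≤ k) :
    (8 * Real.exp 1)⁻¹ * ((n : ℝ) * Real.log (2 * (k : ℝ) + 1)) ^ (-(1 / 2) : ℝ) ≤
      (volume.real (Pos' k n) / volume.real (Metric.closedBall (0 : U (2 * k) n) 1)) ^
        (1 / (Module.finrank ℝ (U (2 * k) n) : ℝ)) := by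
  have hd := finrank_U_pos hn hk
  have hL1 := one_le_log_two_mul_add_one hk
  set d := Module.finrank ℝ (U (2 * k) n) with hd_def
  set L := Real.log (2 * (k : ℝ) + 1)
  have hn' : (0 : ℝ) < n := by positivity
  have hnL : 0 < n * L := by positivity
  -- With `p = n⌈L⌉ ≤ 2nL`, valid as `L ≥ 1`, one has `8e²p ≤ 16e²nL = M²`.
  set M := 4 * Real.exp 1 * √(n * L) with hM_def
  have hM : 0 < M := by positivity
  have hceil : (⌈L⌉₊ : ℝ) ≤ 2 * L := by linarith [(Nat.ceil_lt_add_one (by positivity : 0 ≤ L)).le]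
  have hM2 : Real.exp 2 * 8 * ((n * ⌈L⌉₊ : ℕ) : ℝ) ≤ M ^ 2 := by
    rw [hM_def, mul_pow, mul_pow, Real.sq_sqrt hnL.le, ← Real.exp_nat_mul]
    push_cast
    rw [mul_one]
    have := mul_le_mul_of_nonneg_left hceil (by positivity : 0 ≤ Real.exp 2 * 8 * n)
    linarith
  have hvol := volume_closedBall_le_mul_volume_Pos' (n := n) hk hM (p := n * ⌈L⌉₊)
    (by push_cast; gcongr; exact Nat.le_ceil L) hM2
  have hvol' : volume.real (Metric.closedBall (0 : U (2 * k) n) 1) ≤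
      2 * (M ^ d * volume.real (Pos' k n)) := by
    have h := ENNReal.toReal_mono (ENNReal.mul_ne_top ENNReal.ofNat_ne_top
      (ENNReal.mul_ne_top ENNReal.ofReal_ne_top (measure_Pos'_ne_top k n))) hvol
    rwa [ENNReal.toReal_mul, ENNReal.toReal_mul, ENNReal.toReal_ofReal (by positivity)] at h
  have hBpos : 0 < volume.real (Metric.closedBall (0 : U (2 * k) n) 1) :=
    ENNReal.toReal_pos (Metric.measure_closedBall_pos _ _ one_pos).ne'
      measure_closedBall_lt_top.ne
  have hratio : (2 * M)⁻¹ ^ d ≤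
      volume.real (Pos' k n) / volume.real (Metric.closedBall (0 : U (2 * k) n) 1) := by
    rw [le_div_iff₀ hBpos, inv_pow, inv_mul_le_iff₀ (by positivity), mul_pow]
    refine hvol'.trans ?_
    -- The factor lost to Markov is absorbed since `d ≥ 1`, turning `4e` into the final `8e`.
    have h2 : (2 : ℝ) ≤ 2 ^ d := le_self_pow₀ (by norm_num) hd.ne'
    rw [← mul_assoc]
    gcongr
  have hroot : (2 * M)⁻¹ = ((2 * M)⁻¹ ^ d) ^ (1 / (d : ℝ)) := by
    rw [one_div, Real.pow_rpow_inv_natCast (by positivity) hd.ne']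
  calc _ = (2 * M)⁻¹ := by
        rw [Real.rpow_neg hnL.le, ← Real.sqrt_eq_rpow, ← mul_inv, hM_def]
        ring
    _ = ((2 * M)⁻¹ ^ d) ^ (1 / (d : ℝ)) := hroot
    _ ≤ _ := by gcongr

end NonnegForms

theorem theorem4p3 :
    ∃ α : ℝ, 0 < α ∧ ∀ (n k : ℕ) [NeZero n], 2 ≤ n → 1 ≤ k →
      Module.finrank ℝ (NonnegForms.U (2 * k) n) = (n + 2 * k - 1).choose (2 * k) - 1 ∧
      α * ((n : ℝ) * Real.log (2 * (k : ℝ) + 1)) ^ (-(1 / 2) : ℝ) ≤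
        (MeasureTheory.volume.real (NonnegForms.Pos' k n) /
          MeasureTheory.volume.real (Metric.closedBall (0 : NonnegForms.U (2 * k) n) 1)) ^
            (1 / (Module.finrank ℝ (NonnegForms.U (2 * k) n) : ℝ)) :=
  ⟨(8 * Real.exp 1)⁻¹, by positivity, fun n k _ hn hk =>
    ⟨NonnegForms.finrank_U k n, NonnegForms.le_volume_ratio hn hk⟩⟩
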